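/- For complex numbers $A,q$ and $N\ge 0$ put $(A;q)_N=\prod_{k=0}^{N-1}(1-Aq^k)$ and, for $|q|<1$, $(A;q)_\infty=\lim_{N\to\infty}(A;q)_N$. Then for every complex $q$ with $|q|<1$ the three series below converge absolutely and $$\sum_{n=1}^\infty\frac{q^{2n}}{(1-q^{2n})^2(-q^{n+1};q)_n(q^{n+1};q)_\infty}=\frac{1}{(q;q)_\infty}\sum_{n=1}^\infty\frac{nq^{2n}}{1-q^{2n}}+\frac{1}{(q;q)_\infty}\sum_{n=1}^\infty\frac{(-1)^n(1+q^n)}{(1-q^{2n})^2}\,q^{\frac{3n(n+1)}{2}}.$$ -/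

import Mathlib

open Filter Topology

/-- The finite `q`-Pochhammer symbol `(A; q)_N = (1 - A)(1 - A q) ⋯ (1 - A q ^ (N - 1))`. -/
noncomputable def qPochhammer (A q : ℂ) (N : ℕ) : ℂ :=
  ∏ k ∈ Finset.range N, (1 - A * q ^ k)

/-- The infinite `q`-Pochhammer symbol `(A; q)_∞ = (1 - A)(1 - A q)(1 - A q ^ 2) ⋯`, used for
`‖q‖ < 1`; by `tendsto_qPochhammer` it is then the limit of `(A; q)_N` as `N → ∞`. -/
noncomputable def qPochhammerInf (A q : ℂ) : ℂ :=
  ∏' k : ℕ, (1 - A * q ^ k)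

theorem tendsto_qPochhammer (A : ℂ) {q : ℂ} (hq : ‖q‖ < 1) :
    Tendsto (qPochhammer A q) atTop (𝓝 (qPochhammerInf A q)) := by
  have hs : Summable fun k : ℕ => ‖-(A * q ^ k)‖ := by
    simp only [norm_neg, norm_mul, norm_pow]
    exact (summable_geometric_of_lt_one (norm_nonneg q) hq).mul_left _
  have hm : Multipliable fun k : ℕ => (1 - A * q ^ k) := by
    simpa only [← sub_eq_add_neg] using multipliable_one_add_of_summable hs
  exact hm.hasProd.tendsto_prod_nat

/-! Put `x = q ^ 2`. The sequences `α_0 = 1`, `α_r = pentagonalAlpha q r` and `β_n = 1 / ((x; x)_n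
(-q; q)_{2n})` form a Bailey pair relative to `1` in base `x`, that is, `β_n = ∑ α_r / ((x; x)_{n-r}
(x; x)_{n+r})` (`baileySum_self`). A degenerate limit of Bailey's lemma says `∑ x^n (x; x)_{n-1}^2
β_n = ∑ x^n / (1 - x^n)^2 + ∑ α_r x^r / (1 - x^r)^2`, sums over positive indices; it is proved here
as the limit of an exact finite identity (`sum_mul_baileySum`). The left side is `(q; q)_∞` times
the required series, term by term (`pow_div_eq_mul_baileySum`), and the first sum on the right is a
Lambert series (`tsum_pow_div_one_sub_sq`). -/

theorem qPochhammer_zero (A q : ℂ) : qPochhammer A q 0 = 1 := by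
  simp [qPochhammer]

theorem qPochhammer_succ (A q : ℂ) (n : ℕ) :
    qPochhammer A q (n + 1) = qPochhammer A q n * (1 - A * q ^ n) :=
  Finset.prod_range_succ _ _

theorem qPochhammer_add (A q : ℂ) (m n : ℕ) :
    qPochhammer A q (m + n) = qPochhammer A q m * qPochhammer (A * q ^ m) q n := by
  simp only [qPochhammer, Finset.prod_range_add, pow_add, mul_assoc]

theorem qPochhammer_sq_sq_succ (q : ℂ) (n : ℕ) :
    qPochhammer (q ^ 2) (q ^ 2) (n + 1) =
      qPochhammer (q ^ 2) (q ^ 2) n * (1 - q ^ (2 * n + 2)) := by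
  rw [qPochhammer_succ]; ring

theorem qPochhammer_mul_qPochhammer_neg (q : ℂ) (n : ℕ) :
    qPochhammer q q n * qPochhammer (-q) q n = qPochhammer (q ^ 2) (q ^ 2) n := by
  simp only [qPochhammer, ← Finset.prod_mul_distrib]
  exact Finset.prod_congr rfl fun k _ => by ring

theorem norm_mul_pow_lt_one {A q : ℂ} (hA : ‖A‖ < 1) (hq : ‖q‖ < 1) (k : ℕ) :
    ‖A * q ^ k‖ < 1 := by
  rw [norm_mul, norm_pow]
  exact mul_lt_one_of_nonneg_of_lt_one_left (norm_nonneg A) hA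
    (pow_le_one₀ (norm_nonneg q) hq.le)

theorem one_sub_ne_zero_of_norm_lt_one {z : ℂ} (hz : ‖z‖ < 1) : 1 - z ≠ 0 := by
  intro h
  rw [← sub_eq_zero.mp h] at hz
  simp at hz

theorem one_sub_pow_ne_zero {q : ℂ} (hq : ‖q‖ < 1) {n : ℕ} (hn : n ≠ 0) : 1 - q ^ n ≠ 0 :=
  one_sub_ne_zero_of_norm_lt_one (by rw [norm_pow]; exact pow_lt_one₀ (norm_nonneg q) hq hn)

theorem one_add_pow_ne_zero {q : ℂ} (hq : ‖q‖ < 1) {n : ℕ} (hn : n ≠ 0) : 1 + q ^ n ≠ 0 := by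
  rw [← sub_neg_eq_add]
  exact one_sub_ne_zero_of_norm_lt_one
    (by rw [norm_neg, norm_pow]; exact pow_lt_one₀ (norm_nonneg q) hq hn)

theorem qPochhammer_ne_zero {A q : ℂ} (hA : ‖A‖ < 1) (hq : ‖q‖ < 1) (n : ℕ) :
    qPochhammer A q n ≠ 0 :=
  Finset.prod_ne_zero_iff.mpr fun k _ =>
    one_sub_ne_zero_of_norm_lt_one (norm_mul_pow_lt_one hA hq k)

theorem qPochhammerInf_ne_zero {A q : ℂ} (hA : ‖A‖ < 1) (hq : ‖q‖ < 1) :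
    qPochhammerInf A q ≠ 0 := by
  simp only [qPochhammerInf, sub_eq_add_neg]
  refine tprod_one_add_ne_zero_of_summable (fun k => ?_) ?_
  · rw [← sub_eq_add_neg]
    exact one_sub_ne_zero_of_norm_lt_one (norm_mul_pow_lt_one hA hq k)
  · simp only [norm_neg, norm_mul, norm_pow]
    exact (summable_geometric_of_lt_one (norm_nonneg q) hq).mul_left _

theorem qPochhammer_mul_qPochhammerInf (A : ℂ) {q : ℂ} (hq : ‖q‖ < 1) (m : ℕ) :
    qPochhammer A q m * qPochhammerInf (A * q ^ m) q = qPochhammerInf A q := by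
  refine tendsto_nhds_unique ((tendsto_qPochhammer (A * q ^ m) hq).const_mul _) ?_
  simp only [← qPochhammer_add]
  exact (tendsto_qPochhammer A hq).comp (tendsto_atTop_mono (fun n => Nat.le_add_left n m) tendsto_id)

theorem exists_norm_qPochhammer_le (A : ℂ) {q : ℂ} (hq : ‖q‖ < 1) :
    ∃ C, ∀ n, ‖qPochhammer A q n‖ ≤ C := by
  obtain ⟨C, hC⟩ := (tendsto_qPochhammer A hq).norm.bddAbove_range
  exact ⟨C, fun n => hC ⟨n, rfl⟩⟩

theorem exists_norm_qPochhammer_inv_le {A q : ℂ} (hA : ‖A‖ < 1) (hq : ‖q‖ < 1) :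
    ∃ C, ∀ n, ‖(qPochhammer A q n)⁻¹‖ ≤ C := by
  obtain ⟨C, hC⟩ :=
    ((tendsto_qPochhammer A hq).inv₀ (qPochhammerInf_ne_zero hA hq)).norm.bddAbove_range
  exact ⟨C, fun n => hC ⟨n, rfl⟩⟩

/-! ### The Bailey pair in base `q ^ 2` -/

/-- The pentagonalNat number `r (3 r - 1) / 2`. -/
def pentagonalNat (r : ℕ) : ℕ := ∑ i ∈ Finset.range r, (3 * i + 1)

theorem pentagonal_succ (r : ℕ) : pentagonalNat (r + 1) = pentagonalNat r + (3 * r + 1) :=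
  Finset.sum_range_succ _ _

theorem two_mul_pentagonal_add (r : ℕ) : 2 * pentagonalNat r + r = 3 * r ^ 2 := by
  induction r with
  | zero => rfl
  | succ r ih => rw [pentagonal_succ]; linarith

theorem three_mul_mul_succ_div_two (r : ℕ) :
    3 * r * (r + 1) / 2 = pentagonalNat r + 2 * r := by
  have h := two_mul_pentagonal_add r
  have : 3 * r * (r + 1) = 2 * (pentagonalNat r + 2 * r) := by linarith
  omega

/-- For `r ≥ 1`, the `r`-th term `(-1) ^ r (1 + q ^ r) q ^ (r (3 r - 1) / 2)` of the Bailey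
sequence. -/
noncomputable def pentagonalAlpha (q : ℂ) (r : ℕ) : ℂ :=
  (-1) ^ r * (1 + q ^ r) * q ^ pentagonalNat r

/-- The partial Bailey sum `∑ α_r / ((q²; q²)_{n-r} (q²; q²)_{n+r})` over `0 ≤ r ≤ R`. -/
noncomputable def baileySum (q : ℂ) (n R : ℕ) : ℂ :=
  1 / qPochhammer (q ^ 2) (q ^ 2) n ^ 2 +
    ∑ r ∈ Finset.range R, pentagonalAlpha q (r + 1) /
      (qPochhammer (q ^ 2) (q ^ 2) (n - (r + 1)) * qPochhammer (q ^ 2) (q ^ 2) (n + (r + 1)))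

theorem baileySum_succ (q : ℂ) (n R : ℕ) :
    baileySum q n (R + 1) = baileySum q n R + pentagonalAlpha q (R + 1) /
      (qPochhammer (q ^ 2) (q ^ 2) (n - (R + 1)) * qPochhammer (q ^ 2) (q ^ 2) (n + (R + 1))) := by
  simp only [baileySum, Finset.sum_range_succ, add_assoc]

theorem norm_sq_lt_one {q : ℂ} (hq : ‖q‖ < 1) : ‖q ^ 2‖ < 1 := by
  rw [norm_pow]; exact pow_lt_one₀ (norm_nonneg q) hq two_ne_zero

/-- Both sums are cut at the same `R`, with `n = m + R`. The error in the expected recurrence for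
`β_n` then has a closed form, which makes the recurrence provable by induction on the cut. -/
theorem baileySum_sub_baileySum {q : ℂ} (hq : ‖q‖ < 1) (m R : ℕ) :
    (1 - q ^ (4 * (m + R) + 4)) * (1 + q ^ (2 * (m + R) + 1)) * baileySum q (m + R + 1) R -
        baileySum q (m + R) R =
      (-1) ^ R * q ^ pentagonalNat (R + 1) *
        (q ^ (2 * m) + q ^ (2 * m + R + 1) * (1 + q ^ (2 * (m + R) + 1)) +
          q ^ (2 * (m + R) + 1)) /
        (qPochhammer (q ^ 2) (q ^ 2) m * qPochhammer (q ^ 2) (q ^ 2) (m + 2 * R + 1)) := by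
  have hp := qPochhammer_ne_zero (norm_sq_lt_one hq) (norm_sq_lt_one hq)
  -- The step keeps `n = m + R` fixed, so it uses the hypothesis at `m + 1`.
  induction R generalizing m with
  | zero =>
    have h1 := hp m
    have h2 : 1 - q ^ (2 * m + 2) ≠ 0 := one_sub_pow_ne_zero hq (by omega)
    simp only [baileySum, Finset.range_zero, Finset.sum_empty, add_zero, mul_zero,
      qPochhammer_sq_sq_succ, pentagonal_succ, pow_zero, zero_add]
    simp only [pentagonalNat, Finset.range_zero, Finset.sum_empty, zero_add]
    field_simp
    ring
  | succ R ih =>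
    have h1 := hp m
    have h2 : 1 - q ^ (2 * m + 2) ≠ 0 := one_sub_pow_ne_zero hq (by omega)
    have h3 := hp (m + 2 * R + 2)
    have h4 : 1 - q ^ (2 * (m + 2 * R + 2) + 2) ≠ 0 := one_sub_pow_ne_zero hq (by omega)
    have ih := ih (m + 1)
    rw [show m + 1 + R = m + (R + 1) by ring, show m + 1 + 2 * R + 1 = m + 2 * R + 2 by ring,
      qPochhammer_sq_sq_succ] at ih
    rw [baileySum_succ, baileySum_succ, show m + (R + 1) + 1 - (R + 1) = m + 1 by omega,
      show m + (R + 1) - (R + 1) = m by omega,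
      show m + (R + 1) + 1 + (R + 1) = m + 2 * R + 2 + 1 by ring,
      show m + (R + 1) + (R + 1) = m + 2 * R + 2 by ring,
      show m + 2 * (R + 1) + 1 = m + 2 * R + 2 + 1 by ring,
      qPochhammer_sq_sq_succ q m, qPochhammer_sq_sq_succ q (m + 2 * R + 2), mul_add,
      add_sub_add_comm, ih, pentagonalAlpha, pentagonal_succ (R + 1)]
    field_simp
    ring

/-- At `m = 0` the error factors through `(1 + q ^ (n + 1)) * (1 + q ^ (2 * n + 1))` and cancels the
one extra term `r = n + 1` of the longer sum. -/
theorem baileySum_self_succ {q : ℂ} (hq : ‖q‖ < 1) (n : ℕ) :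
    (1 - q ^ (4 * n + 4)) * (1 + q ^ (2 * n + 1)) * baileySum q (n + 1) (n + 1) =
      baileySum q n n := by
  have hp := qPochhammer_ne_zero (norm_sq_lt_one hq) (norm_sq_lt_one hq)
  have h := baileySum_sub_baileySum hq 0 n
  simp only [zero_add, mul_zero] at h
  have h1 := hp (2 * n + 1)
  have h2 : 1 - q ^ (2 * (2 * n + 1) + 2) ≠ 0 := one_sub_pow_ne_zero hq (by omega)
  rw [baileySum_succ, mul_add, ← sub_eq_zero, add_sub_right_comm, h, Nat.sub_self,
    show n + 1 + (n + 1) = 2 * n + 1 + 1 by ring, qPochhammer_sq_sq_succ q (2 * n + 1), pentagonalAlpha,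
    qPochhammer_zero]
  field_simp
  ring

theorem baileySum_self {q : ℂ} (hq : ‖q‖ < 1) (n : ℕ) :
    baileySum q n n =
      1 / (qPochhammer (q ^ 2) (q ^ 2) n * qPochhammer (-q) q (2 * n)) := by
  have hq' : ‖-q‖ < 1 := by rwa [norm_neg]
  have hp := qPochhammer_ne_zero (norm_sq_lt_one hq) (norm_sq_lt_one hq)
  induction n with
  | zero => simp [baileySum, qPochhammer_zero]
  | succ n ih =>
    have h1 : 1 - q ^ (2 * n + 2) ≠ 0 := one_sub_pow_ne_zero hq (by omega)
    have h2 : 1 + q ^ (2 * n + 1) ≠ 0 := one_add_pow_ne_zero hq (by omega)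
    have h3 : 1 + q ^ (2 * n + 2) ≠ 0 := one_add_pow_ne_zero hq (by omega)
    have h4 := hp n
    have h5 := qPochhammer_ne_zero hq' hq (2 * n)
    have h6 : 1 - q ^ (4 * n + 4) ≠ 0 := one_sub_pow_ne_zero hq (by omega)
    have h := baileySum_self_succ hq n
    rw [ih] at h
    have e : qPochhammer (-q) q (2 * (n + 1)) =
        qPochhammer (-q) q (2 * n) * (1 + q ^ (2 * n + 1)) * (1 + q ^ (2 * n + 2)) := by
      rw [show 2 * (n + 1) = 2 * n + 1 + 1 by ring, qPochhammer_succ, qPochhammer_succ]; ring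
    rw [e, qPochhammer_sq_sq_succ]
    apply mul_left_cancel₀ (mul_ne_zero h6 h2)
    rw [h]
    field_simp
    ring

/-! ### The finite form of the Bailey transform -/

/-- With `x = q ^ 2`, `M = m + r + 2` and `s = r + 1`, this rests on `(1 - x^M)^2 - (1 - x^(M-s)) (1
- x^(M+s)) = x^(M-s) (1 - x^s)^2`. -/
theorem pentagonalAlpha_mul_ratio_succ_sub {q : ℂ} (hq : ‖q‖ < 1) (m r : ℕ) :
    pentagonalAlpha q (r + 1) * q ^ (2 * r + 2) / (1 - q ^ (2 * r + 2)) ^ 2 *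
        (qPochhammer (q ^ 2) (q ^ 2) (m + r + 2) ^ 2 /
          (qPochhammer (q ^ 2) (q ^ 2) (m + 1) * qPochhammer (q ^ 2) (q ^ 2) (m + 2 * r + 3))) =
      pentagonalAlpha q (r + 1) * q ^ (2 * r + 2) / (1 - q ^ (2 * r + 2)) ^ 2 *
        (qPochhammer (q ^ 2) (q ^ 2) (m + r + 1) ^ 2 /
          (qPochhammer (q ^ 2) (q ^ 2) m * qPochhammer (q ^ 2) (q ^ 2) (m + 2 * r + 2))) +
      q ^ (2 * (m + r + 1) + 2) * qPochhammer (q ^ 2) (q ^ 2) (m + r + 1) ^ 2 *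
        (pentagonalAlpha q (r + 1) /
          (qPochhammer (q ^ 2) (q ^ 2) (m + 1) * qPochhammer (q ^ 2) (q ^ 2) (m + 2 * r + 3))) := by
  have hp := qPochhammer_ne_zero (norm_sq_lt_one hq) (norm_sq_lt_one hq)
  have h1 := hp m
  have h2 : 1 - q ^ (2 * m + 2) ≠ 0 := one_sub_pow_ne_zero hq (by omega)
  have h3 := hp (m + 2 * r + 2)
  have h4 : 1 - q ^ (2 * (m + 2 * r + 2) + 2) ≠ 0 := one_sub_pow_ne_zero hq (by omega)
  have h5 : 1 - q ^ (2 * r + 2) ≠ 0 := one_sub_pow_ne_zero hq (by omega)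
  rw [qPochhammer_sq_sq_succ q m, qPochhammer_sq_sq_succ q (m + 2 * r + 2),
    qPochhammer_sq_sq_succ q (m + r + 1)]
  field_simp
  ring

theorem sum_mul_baileySum {q : ℂ} (hq : ‖q‖ < 1) (N : ℕ) :
    ∑ n ∈ Finset.range N,
        q ^ (2 * n + 2) * qPochhammer (q ^ 2) (q ^ 2) n ^ 2 * baileySum q (n + 1) (n + 1) =
      ∑ n ∈ Finset.range N, q ^ (2 * n + 2) / (1 - q ^ (2 * n + 2)) ^ 2 +
      ∑ r ∈ Finset.range N,
        pentagonalAlpha q (r + 1) * q ^ (2 * r + 2) / (1 - q ^ (2 * r + 2)) ^ 2 *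
          (qPochhammer (q ^ 2) (q ^ 2) N ^ 2 /
            (qPochhammer (q ^ 2) (q ^ 2) (N - (r + 1)) *
              qPochhammer (q ^ 2) (q ^ 2) (N + (r + 1)))) := by
  have hp := qPochhammer_ne_zero (norm_sq_lt_one hq) (norm_sq_lt_one hq)
  induction N with
  | zero => simp
  | succ N ih =>
    have hN := hp N
    have hN' : 1 - q ^ (2 * N + 2) ≠ 0 := one_sub_pow_ne_zero hq (by omega)
    have hN2 := hp (N + 1 + (N + 1))
    -- The index `r = N` is new on the right, so it has no predecessor to telescope against and is
    -- matched directly.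
    have hlast : q ^ (2 * N + 2) * qPochhammer (q ^ 2) (q ^ 2) N ^ 2 *
          (pentagonalAlpha q (N + 1) /
            (qPochhammer (q ^ 2) (q ^ 2) (N + 1 - (N + 1)) *
              qPochhammer (q ^ 2) (q ^ 2) (N + 1 + (N + 1)))) =
        pentagonalAlpha q (N + 1) * q ^ (2 * N + 2) / (1 - q ^ (2 * N + 2)) ^ 2 *
          (qPochhammer (q ^ 2) (q ^ 2) (N + 1) ^ 2 /
            (qPochhammer (q ^ 2) (q ^ 2) (N + 1 - (N + 1)) *
              qPochhammer (q ^ 2) (q ^ 2) (N + 1 + (N + 1)))) := by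
      rw [Nat.sub_self, qPochhammer_zero, qPochhammer_sq_sq_succ q N]
      field_simp
    have hzero : q ^ (2 * N + 2) * qPochhammer (q ^ 2) (q ^ 2) N ^ 2 *
          (1 / qPochhammer (q ^ 2) (q ^ 2) (N + 1) ^ 2) =
        q ^ (2 * N + 2) / (1 - q ^ (2 * N + 2)) ^ 2 := by
      rw [qPochhammer_sq_sq_succ]
      field_simp
    have hsum : ∑ r ∈ Finset.range N,
        pentagonalAlpha q (r + 1) * q ^ (2 * r + 2) / (1 - q ^ (2 * r + 2)) ^ 2 *
          (qPochhammer (q ^ 2) (q ^ 2) (N + 1) ^ 2 /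
            (qPochhammer (q ^ 2) (q ^ 2) (N + 1 - (r + 1)) *
              qPochhammer (q ^ 2) (q ^ 2) (N + 1 + (r + 1)))) =
        ∑ r ∈ Finset.range N,
          pentagonalAlpha q (r + 1) * q ^ (2 * r + 2) / (1 - q ^ (2 * r + 2)) ^ 2 *
            (qPochhammer (q ^ 2) (q ^ 2) N ^ 2 /
              (qPochhammer (q ^ 2) (q ^ 2) (N - (r + 1)) *
                qPochhammer (q ^ 2) (q ^ 2) (N + (r + 1)))) +
        q ^ (2 * N + 2) * qPochhammer (q ^ 2) (q ^ 2) N ^ 2 *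
          ∑ r ∈ Finset.range N, pentagonalAlpha q (r + 1) /
            (qPochhammer (q ^ 2) (q ^ 2) (N + 1 - (r + 1)) *
              qPochhammer (q ^ 2) (q ^ 2) (N + 1 + (r + 1))) := by
      rw [Finset.mul_sum, ← Finset.sum_add_distrib]
      refine Finset.sum_congr rfl fun r hr => ?_
      obtain ⟨m, rfl⟩ : ∃ m, N = m + r + 1 :=
        ⟨N - (r + 1), by have := Finset.mem_range.mp hr; omega⟩
      rw [show m + r + 1 + 1 - (r + 1) = m + 1 by omega, show m + r + 1 - (r + 1) = m by omega,
        show m + r + 1 + 1 + (r + 1) = m + 2 * r + 3 by ring,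
        show m + r + 1 + (r + 1) = m + 2 * r + 2 by ring]
      exact pentagonalAlpha_mul_ratio_succ_sub hq m r
    rw [Finset.sum_range_succ, ih, Finset.sum_range_succ _ N, Finset.sum_range_succ _ N, hsum,
      ← hlast, baileySum_succ, baileySum, ← hzero]
    ring

/-! ### Convergence and passage to the limit -/

theorem norm_inv_one_sub_pow_le {q : ℂ} (hq : ‖q‖ < 1) {n : ℕ} (hn : n ≠ 0) :
    ‖(1 - q ^ n)⁻¹‖ ≤ (1 - ‖q‖)⁻¹ := by
  rw [norm_inv]
  have h1 : ‖q ^ n‖ ≤ ‖q‖ := by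
    rw [norm_pow]; exact pow_le_of_le_one (norm_nonneg q) hq.le hn
  have h2 := norm_sub_norm_le (1 : ℂ) (q ^ n)
  rw [norm_one] at h2
  exact inv_anti₀ (by linarith) (by linarith)

theorem summable_bdd_mul_pow {q : ℂ} (hq : ‖q‖ < 1) {f : ℕ → ℂ} {C : ℝ} (hf : ∀ n, ‖f n‖ ≤ C) :
    Summable fun n => f n * (q ^ (2 * n + 2)) := by
  refine Summable.of_norm_bounded
    (g := fun n => C * ‖q ^ 2‖ ^ (n + 1))
    ((((summable_nat_add_iff 1).mpr
      (summable_geometric_of_lt_one (norm_nonneg _) (norm_sq_lt_one hq))).mul_left C)) fun n => ?_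
  rw [norm_mul, show q ^ (2 * n + 2) = (q ^ 2) ^ (n + 1) by ring, norm_pow (q ^ 2)]
  exact mul_le_mul_of_nonneg_right (hf n) (by positivity)

theorem summable_pow_div_one_sub_pow_sq {q : ℂ} (hq : ‖q‖ < 1) :
    Summable fun n : ℕ => q ^ (2 * n + 2) / (1 - q ^ (2 * n + 2)) ^ 2 := by
  refine (summable_bdd_mul_pow hq (f := fun n => ((1 - q ^ (2 * n + 2))⁻¹) ^ 2)
    (C := ((1 - ‖q‖)⁻¹) ^ 2) fun n => ?_).congr fun n => by rw [inv_pow]; ring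
  rw [norm_pow]
  exact pow_le_pow_left₀ (norm_nonneg _) (norm_inv_one_sub_pow_le hq (by omega)) 2

theorem norm_pentagonalAlpha_le {q : ℂ} (hq : ‖q‖ < 1) (r : ℕ) : ‖pentagonalAlpha q r‖ ≤ 2 := by
  have hpow (k : ℕ) : ‖q ^ k‖ ≤ 1 := by
    rw [norm_pow]; exact pow_le_one₀ (norm_nonneg q) hq.le
  have h := norm_add_le (1 : ℂ) (q ^ r)
  have h1 := hpow r
  rw [norm_one] at h
  rw [pentagonalAlpha, norm_mul, norm_mul, norm_pow, norm_neg, norm_one, one_pow, one_mul]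
  calc _ ≤ (2 : ℝ) * 1 := mul_le_mul (by linarith) (hpow _) (norm_nonneg _) (by norm_num)
    _ = 2 := mul_one 2

theorem summable_pentagonalAlpha_mul {q : ℂ} (hq : ‖q‖ < 1) :
    Summable fun r : ℕ =>
      pentagonalAlpha q (r + 1) * q ^ (2 * r + 2) / (1 - q ^ (2 * r + 2)) ^ 2 := by
  refine (summable_bdd_mul_pow hq
    (f := fun n => pentagonalAlpha q (n + 1) * ((1 - q ^ (2 * n + 2))⁻¹) ^ 2)
    (C := 2 * ((1 - ‖q‖)⁻¹) ^ 2) fun n => ?_).congr fun n => by rw [inv_pow]; ring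
  rw [norm_mul, norm_pow]
  exact mul_le_mul (norm_pentagonalAlpha_le hq _)
    (pow_le_pow_left₀ (norm_nonneg _) (norm_inv_one_sub_pow_le hq (by omega)) 2)
    (by positivity) (by norm_num)

theorem summable_mul_baileySum {q : ℂ} (hq : ‖q‖ < 1) :
    Summable fun n : ℕ =>
      q ^ (2 * n + 2) * qPochhammer (q ^ 2) (q ^ 2) n ^ 2 * baileySum q (n + 1) (n + 1) := by
  have hq2 := norm_sq_lt_one hq
  obtain ⟨C, hC⟩ := exists_norm_qPochhammer_le (q ^ 2) hq2
  obtain ⟨B, hB⟩ := exists_norm_qPochhammer_inv_le hq2 hq2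
  obtain ⟨D, hD⟩ := exists_norm_qPochhammer_inv_le (A := -q) (by rwa [norm_neg]) hq
  have hB0 : 0 ≤ B := (norm_nonneg _).trans (hB 0)
  refine (summable_bdd_mul_pow hq
    (f := fun n => qPochhammer (q ^ 2) (q ^ 2) n ^ 2 *
      ((qPochhammer (q ^ 2) (q ^ 2) (n + 1))⁻¹ * (qPochhammer (-q) q (2 * (n + 1)))⁻¹))
    (C := C ^ 2 * (B * D)) fun n => ?_).congr fun n => by
      rw [baileySum_self hq, one_div, mul_inv]; ring
  rw [norm_mul, norm_pow, norm_mul]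
  exact mul_le_mul (pow_le_pow_left₀ (norm_nonneg _) (hC _) 2)
    (mul_le_mul (hB _) (hD _) (norm_nonneg _) hB0) (by positivity) (by positivity)

/-- For fixed `r` the Pochhammer ratio tends to `1`, and it is bounded uniformly in `N` and `r`, so
dominated convergence applies. -/
theorem tendsto_sum_pentagonalAlpha {q : ℂ} (hq : ‖q‖ < 1) :
    Tendsto (fun N : ℕ => ∑ r ∈ Finset.range N,
        pentagonalAlpha q (r + 1) * q ^ (2 * r + 2) / (1 - q ^ (2 * r + 2)) ^ 2 *
          (qPochhammer (q ^ 2) (q ^ 2) N ^ 2 /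
            (qPochhammer (q ^ 2) (q ^ 2) (N - (r + 1)) *
              qPochhammer (q ^ 2) (q ^ 2) (N + (r + 1))))) atTop
      (𝓝 (∑' r : ℕ,
        pentagonalAlpha q (r + 1) * q ^ (2 * r + 2) / (1 - q ^ (2 * r + 2)) ^ 2)) := by
  have hq2 := norm_sq_lt_one hq
  obtain ⟨C, hC⟩ := exists_norm_qPochhammer_le (q ^ 2) hq2
  obtain ⟨B, hB⟩ := exists_norm_qPochhammer_inv_le hq2 hq2
  have hB0 : 0 ≤ B := (norm_nonneg _).trans (hB 0)
  set c : ℕ → ℂ := fun r =>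
    pentagonalAlpha q (r + 1) * q ^ (2 * r + 2) / (1 - q ^ (2 * r + 2)) ^ 2 with hc
  set p : ℕ → ℂ := qPochhammer (q ^ 2) (q ^ 2) with hp
  have hlim : Tendsto p atTop (𝓝 (qPochhammerInf (q ^ 2) (q ^ 2))) := tendsto_qPochhammer _ hq2
  have hne : qPochhammerInf (q ^ 2) (q ^ 2) ≠ 0 := qPochhammerInf_ne_zero hq2 hq2
  have hT := tendsto_tsum_of_dominated_convergence (𝓕 := atTop)
    (f := fun N r => if r ∈ Finset.range N then
      c r * (p N ^ 2 / (p (N - (r + 1)) * p (N + (r + 1)))) else 0)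
    (g := c) (bound := fun r => ‖c r‖ * (C ^ 2 * (B * B)))
    ((summable_pentagonalAlpha_mul hq).norm.mul_right _) ?_ ?_
  · refine hT.congr fun N => ?_
    rw [tsum_eq_sum (s := Finset.range N) fun r hr => if_neg hr]
    exact Finset.sum_congr rfl fun r hr => if_pos hr
  · intro r
    have h1 : Tendsto (fun N => p (N - (r + 1))) atTop (𝓝 (qPochhammerInf (q ^ 2) (q ^ 2))) :=
      hlim.comp (tendsto_sub_atTop_nat (r + 1))
    have h2 : Tendsto (fun N => p (N + (r + 1))) atTop (𝓝 (qPochhammerInf (q ^ 2) (q ^ 2))) :=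
      hlim.comp (tendsto_add_atTop_nat (r + 1))
    have h3 := ((hlim.pow 2).div (h1.mul h2) (mul_ne_zero hne hne)).const_mul (c r)
    rw [← sq, div_self (pow_ne_zero 2 hne), mul_one] at h3
    refine h3.congr' ?_
    filter_upwards [eventually_gt_atTop r] with N hN
    rw [if_pos (Finset.mem_range.mpr hN)]
    rfl
  · refine Eventually.of_forall fun N r => ?_
    split_ifs
    · rw [norm_mul, div_eq_mul_inv, mul_inv, norm_mul, norm_pow, norm_mul]
      refine mul_le_mul_of_nonneg_left ?_ (norm_nonneg _)
      exact mul_le_mul (pow_le_pow_left₀ (norm_nonneg _) (hC _) 2)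
        (mul_le_mul (hB _) (hB _) (norm_nonneg _) hB0) (by positivity) (by positivity)
    · rw [norm_zero]
      positivity

theorem tsum_mul_baileySum {q : ℂ} (hq : ‖q‖ < 1) :
    ∑' n : ℕ, q ^ (2 * n + 2) * qPochhammer (q ^ 2) (q ^ 2) n ^ 2 * baileySum q (n + 1) (n + 1) =
      ∑' n : ℕ, q ^ (2 * n + 2) / (1 - q ^ (2 * n + 2)) ^ 2 +
      ∑' r : ℕ, pentagonalAlpha q (r + 1) * q ^ (2 * r + 2) / (1 - q ^ (2 * r + 2)) ^ 2 := by
  refine tendsto_nhds_unique (summable_mul_baileySum hq).hasSum.tendsto_sum_nat ?_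
  simp only [sum_mul_baileySum hq]
  exact (summable_pow_div_one_sub_pow_sq hq).hasSum.tendsto_sum_nat.add
    (tendsto_sum_pentagonalAlpha hq)

/-! ### The Lambert series and the conclusion -/

/-- Both sides expand to the double series `∑ c * r ^ (c * d)`, the generating function of the
divisor sum `σ 1`. -/
theorem tsum_pow_div_one_sub_sq {r : ℂ} (hr : ‖r‖ < 1) :
    ∑' n : ℕ+, r ^ (n : ℕ) / (1 - r ^ (n : ℕ)) ^ 2 =
      ∑' n : ℕ+, (n : ℂ) * r ^ (n : ℕ) / (1 - r ^ (n : ℕ)) := by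
  have h := tsum_prod_pow_eq_tsum_sigma 1 hr
  have h' := tsum_pow_div_one_sub_eq_tsum_sigma hr 1
  rw [← h] at h'
  simp only [pow_one] at h'
  rw [h']
  refine tsum_congr fun d => ?_
  have hd : ‖r ^ (d : ℕ)‖ < 1 := by
    rw [norm_pow]; exact pow_lt_one₀ (norm_nonneg r) hr d.ne_zero
  rw [← tsum_coe_mul_geometric_of_norm_lt_one hd,
    ← tsum_zero_pnat_eq_tsum_nat
      (summable_pow_mul_geometric_of_norm_lt_one 1 hd |>.congr fun n => by rw [pow_one])]
  simp [pow_mul]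

theorem summable_coe_mul_pow_div_one_sub_pow {q : ℂ} (hq : ‖q‖ < 1) :
    Summable fun n : ℕ+ => ((n : ℕ) : ℂ) * q ^ (2 * (n : ℕ)) / (1 - q ^ (2 * (n : ℕ))) := by
  have h : Summable fun n : ℕ+ => ((n : ℕ) : ℂ) * (q ^ 2) ^ (n : ℕ) := by
    have := summable_pow_mul_geometric_of_norm_lt_one 1 (norm_sq_lt_one hq)
    simp only [pow_one] at this
    exact this.comp_injective PNat.coe_injective
  refine Summable.of_norm_bounded (h.norm.mul_right (1 - ‖q‖)⁻¹) fun n => ?_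
  rw [div_eq_mul_inv, norm_mul, ← pow_mul]
  exact mul_le_mul_of_nonneg_left
    (norm_inv_one_sub_pow_le hq (mul_ne_zero two_ne_zero n.ne_zero)) (norm_nonneg _)

/-- Complete both shifted products to start at `q` and `-q`; the factor `(q; q)_{n+1} (-q; q)_{n+1}`
that appears is `(q²; q²)_{n+1}`. -/
theorem pow_div_eq_mul_baileySum {q : ℂ} (hq : ‖q‖ < 1) (n : ℕ) :
    q ^ (2 * (n + 1)) /
        ((1 - q ^ (2 * (n + 1))) ^ 2 * qPochhammer (-q ^ (n + 1 + 1)) q (n + 1) *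
          qPochhammerInf (q ^ (n + 1 + 1)) q) =
      1 / qPochhammerInf q q *
        (q ^ (2 * n + 2) * qPochhammer (q ^ 2) (q ^ 2) n ^ 2 * baileySum q (n + 1) (n + 1)) := by
  have hq' : ‖-q‖ < 1 := by rwa [norm_neg]
  have hI := qPochhammer_mul_qPochhammerInf q hq (n + 1)
  have hY := qPochhammer_add (-q) q (n + 1) (n + 1)
  have hp := qPochhammer_mul_qPochhammer_neg q (n + 1)
  rw [qPochhammer_sq_sq_succ] at hp
  have h1 := qPochhammerInf_ne_zero hq hq
  have h2 := qPochhammer_ne_zero hq' hq (n + 1 + (n + 1))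
  have h3 := qPochhammer_ne_zero (norm_sq_lt_one hq) (norm_sq_lt_one hq) n
  have h4 : 1 - q ^ (2 * n + 2) ≠ 0 := one_sub_pow_ne_zero hq (by omega)
  rw [← hI] at h1
  rw [hY] at h2
  rw [baileySum_self hq, ← hI, two_mul (n + 1), hY, qPochhammer_sq_sq_succ,
    show -q ^ (n + 1 + 1) = -q * q ^ (n + 1) by ring, show q ^ (n + 1 + 1) = q * q ^ (n + 1) by ring,
    show n + 1 + (n + 1) = 2 * n + 2 by ring]
  obtain ⟨h5, h6⟩ := mul_ne_zero_iff.mp h1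
  obtain ⟨h7, h8⟩ := mul_ne_zero_iff.mp h2
  rw [one_div_mul_eq_div, mul_one_div, div_div, div_eq_div_iff (by positivity) (by positivity)]
  linear_combination q ^ (2 * n + 2) * qPochhammer (-q * q ^ (n + 1)) q (n + 1) *
    qPochhammerInf (q * q ^ (n + 1)) q * qPochhammer (q ^ 2) (q ^ 2) n *
      (1 - q ^ (2 * n + 2)) * hp

theorem theorem1p3 (q : ℂ) (hq : ‖q‖ < 1) :
    Summable (fun n : ℕ+ =>
      q ^ (2 * (n : ℕ)) /
        ((1 - q ^ (2 * (n : ℕ))) ^ 2 * qPochhammer (-q ^ ((n : ℕ) + 1)) q n *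
          qPochhammerInf (q ^ ((n : ℕ) + 1)) q)) ∧
    Summable (fun n : ℕ+ => ((n : ℕ) : ℂ) * q ^ (2 * (n : ℕ)) / (1 - q ^ (2 * (n : ℕ)))) ∧
    Summable (fun n : ℕ+ =>
      (-1 : ℂ) ^ (n : ℕ) * (1 + q ^ (n : ℕ)) / (1 - q ^ (2 * (n : ℕ))) ^ 2 *
        q ^ (3 * (n : ℕ) * ((n : ℕ) + 1) / 2)) ∧
    ∑' n : ℕ+,
      q ^ (2 * (n : ℕ)) /
        ((1 - q ^ (2 * (n : ℕ))) ^ 2 * qPochhammer (-q ^ ((n : ℕ) + 1)) q n *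
          qPochhammerInf (q ^ ((n : ℕ) + 1)) q) =
      1 / qPochhammerInf q q *
          ∑' n : ℕ+, ((n : ℕ) : ℂ) * q ^ (2 * (n : ℕ)) / (1 - q ^ (2 * (n : ℕ))) +
        1 / qPochhammerInf q q *
          ∑' n : ℕ+,
            (-1 : ℂ) ^ (n : ℕ) * (1 + q ^ (n : ℕ)) / (1 - q ^ (2 * (n : ℕ))) ^ 2 *
              q ^ (3 * (n : ℕ) * ((n : ℕ) + 1) / 2) := by
  have hα (n : ℕ) : (-1 : ℂ) ^ (n + 1) * (1 + q ^ (n + 1)) / (1 - q ^ (2 * (n + 1))) ^ 2 *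
        q ^ (3 * (n + 1) * (n + 1 + 1) / 2) =
      pentagonalAlpha q (n + 1) * q ^ (2 * n + 2) / (1 - q ^ (2 * n + 2)) ^ 2 := by
    -- The natural-number division is exact: the exponent is the pentagonal one of `α` plus the `2 *
    -- (n + 1)` from the Bailey transform.
    rw [three_mul_mul_succ_div_two, pentagonalAlpha, pow_add q (pentagonalNat _)]
    ring
  have hlambert : ∑' n : ℕ+, ((n : ℕ) : ℂ) * q ^ (2 * (n : ℕ)) / (1 - q ^ (2 * (n : ℕ))) =
      ∑' n : ℕ, q ^ (2 * n + 2) / (1 - q ^ (2 * n + 2)) ^ 2 := by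
    simp only [pow_mul q 2]
    rw [← tsum_pow_div_one_sub_sq (norm_sq_lt_one hq),
      tsum_pnat_eq_tsum_succ (f := fun n : ℕ => (q ^ 2) ^ n / (1 - (q ^ 2) ^ n) ^ 2)]
    simp only [← pow_mul, mul_add, mul_one]
  refine ⟨?_, summable_coe_mul_pow_div_one_sub_pow hq, ?_, ?_⟩
  · rw [summable_pnat_iff_summable_succ (f := fun n : ℕ => q ^ (2 * n) /
        ((1 - q ^ (2 * n)) ^ 2 * qPochhammer (-q ^ (n + 1)) q n * qPochhammerInf (q ^ (n + 1)) q))]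
    simp only [pow_div_eq_mul_baileySum hq]
    exact (summable_mul_baileySum hq).mul_left _
  · rw [summable_pnat_iff_summable_succ (f := fun n : ℕ => (-1 : ℂ) ^ n * (1 + q ^ n) /
      (1 - q ^ (2 * n)) ^ 2 * q ^ (3 * n * (n + 1) / 2))]
    simp only [hα]
    exact summable_pentagonalAlpha_mul hq
  · rw [hlambert, tsum_pnat_eq_tsum_succ (f := fun n : ℕ => q ^ (2 * n) /
        ((1 - q ^ (2 * n)) ^ 2 * qPochhammer (-q ^ (n + 1)) q n * qPochhammerInf (q ^ (n + 1)) q)),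
      tsum_pnat_eq_tsum_succ (f := fun n : ℕ => (-1 : ℂ) ^ n * (1 + q ^ n) /
        (1 - q ^ (2 * n)) ^ 2 * q ^ (3 * n * (n + 1) / 2))]
    simp only [pow_div_eq_mul_baileySum hq, hα]
    rw [tsum_mul_left, tsum_mul_baileySum hq, mul_add]
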